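/- Fix a relational schema and sets of constants and variables. Facts are atoms over constants; an instance (database) is a set of facts, and $\mathrm{consts}(I)$ is the set of constants occurring in $I$. A DisGTGD is a sentence $\forall\vec x\,[\beta(\vec x)\to\bigvee_{i=1}^{n}\exists\vec y_i\,\eta_i(\vec x,\vec y_i)]$, $n\ge 1$, where $\beta$ and the $\eta_i$ are finite conjunctions of constant-free atoms, $\mathrm{vars}(\beta)=\vec x$, and some atom of $\beta$ (a guard) contains all of $\vec x$; $\eta_i$ is called full if $\vec y_i$ is empty. A UBCQ over $D$ is a finite disjunction of existentially quantified finite conjunctions of atoms, without free variables and with constants only from $\mathrm{consts}(D)$. **Chase trees.** A chase tree for $I$ and $\Sigma$ is a finite tree of instances with root $I$ in which the children of each inner node $J$ arise by a disjunctive (oblivious) chase step: a rule $\tau\in\Sigma$ as above and a map $h$ with $h(\beta)\subseteq J$ are chosen, and there is one child $J\cup h_i(\eta_i)$ for each head conjunction, where $h_i$ extends $h$ by pairwise distinct constants for $\vec y_i$ that do not occur in $J$. A chase proof of a UBCQ $Q$ from $D$ and $\Sigma$ is a chase tree for $D$ and $\Sigma$ all of whose leaves satisfy $Q$. **Tree-like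 chase trees.** A chase tree is tree-like if each of its instances is equipped with a rooted tree of bags (sets of facts) as follows. The tree of the root instance $I$ is a single node with bag $I$. Each step is triggered in a node $v$ whose bag contains $h(\beta)$. If $\eta_i$ is full, then $h_i(\eta_i)$ is added to the bag of $v$; otherwise a new child of $v$ with bag $h_i(\eta_i)$ is created. Then facts are propagated: certain nodes, among them at least $v$, all ancestors of $v$ and the new child (possibly all nodes), receive every fact of the instance whose constants all occur in a single fact of their bag. **One-pass.** A tree-like chase tree is one-pass if on each thread (path from the root to a leaf) the following holds: whenever a step is triggered in a node outside of the subtree of a node $v$ that is already present, neither this step nor any later step of the thread modifies the subtree of $v$ (changes a bag in it or adds a node to it). In particular, facts then reach only non-strict ancestors of the triggered node, and the new child. **Theorem.** Let $\Sigma$ be a set of DisGTGDs and $D$ an instance such that infinitely many constants do not occur in $D$ (for example, a finite database over an infinite set of constants). Then: 1. For every UBCQ $Q$ over $D$: $Q$ has a chase proof from $D$ and $\Sigma$ if and only if it has a one-pass chase proof from $D$ and $\Sigma$ (a chase proof that is a one-pass chase tree). 2. For every tree-like chase tree $T$ for $D$ and $\Sigma$ there is a one-pass chase tree $\overline T$ for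 $D$ and $\Sigma$ such that for every leaf $\overline L$ of $\overline T$ there are a leaf $L$ of $T$ and a homomorphism $h\colon L\to\overline L$ (a map of constants that sends facts to facts) with $h(c)=c$ for all $c\in\mathrm{consts}(D)$. -/

import Mathlib

namespace DisChase

universe u v w x

/-- Relational atoms over a schema `R` with arities `ar`, with arguments taken from `T`. -/
structure Atom {R : Type u} (ar : R → ℕ) (T : Type v) where
  rel : R
  args : Fin (ar rel) → T

namespace Atom

variable {R : Type u} {ar : R → ℕ} {T : Type v} {T' : Type w}

/-- Replace the arguments of an atom along `f`. -/
def map (f : T → T') (A : Atom ar T) : Atom ar T' := ⟨A.rel, fun i => f (A.args i)⟩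

/-- The set of arguments of an atom. -/
def terms (A : Atom ar T) : Set T := Set.range A.args

end Atom

/-- The terms (variables or constants) occurring in a set of atoms. -/
def termsOf {R : Type u} {ar : R → ℕ} {T : Type v} (S : Set (Atom ar T)) : Set T :=
  {t | ∃ A ∈ S, t ∈ A.terms}

/-- A fact is an atom all of whose arguments are constants. -/
abbrev Fact {R : Type u} (ar : R → ℕ) (C : Type v) := Atom ar C

/-- A homomorphism between instances: a map of constants that sends facts to facts. -/
def IsHom {R : Type u} {ar : R → ℕ} {C : Type v} (g : C → C) (I J : Set (Fact ar C)) : Prop :=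
  ∀ F ∈ I, F.map g ∈ J

/-! ### Queries -/

/-- A boolean conjunctive query: a finite set of atoms over variables (all of them existentially
quantified) and constants. -/
abbrev BCQ {R : Type u} (ar : R → ℕ) (C : Type v) (V : Type w) := Finset (Atom ar (V ⊕ C))

/-- A union of boolean conjunctive queries. -/
abbrev UBCQ {R : Type u} (ar : R → ℕ) (C : Type v) (V : Type w) := Finset (BCQ ar C V)

section Queries

variable {R : Type u} {ar : R → ℕ} {C : Type v} {V : Type w}

def BCQ.Holds (q : BCQ ar C V) (I : Set (Fact ar C)) : Prop :=
  ∃ s : V → C, ∀ A ∈ q, A.map (Sum.elim s id) ∈ I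

def UBCQ.Holds (Q : UBCQ ar C V) (I : Set (Fact ar C)) : Prop :=
  ∃ q ∈ Q, BCQ.Holds q I

/-- `Q` is a query over the instance `D`: each constant of `Q` occurs in `D`. -/
def UBCQ.Over (Q : UBCQ ar C V) (D : Set (Fact ar C)) : Prop :=
  ∀ q ∈ Q, ∀ A ∈ q, ∀ c : C, Sum.inr c ∈ A.terms → c ∈ termsOf D

end Queries

/-! ### Dependencies -/

/-- A disjunctive tuple-generating dependency `β → ⋁ ∃ y, η`. The body and each of the (one or
more) head conjunctions are finite sets of constant-free atoms; the variables of a head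
conjunction that do not occur in the body are existentially quantified. -/
structure DisTGD {R : Type u} (ar : R → ℕ) (V : Type w) where
  body : Finset (Atom ar V)
  head : Finset (Finset (Atom ar V))
  head_nonempty : head.Nonempty

section Dependencies

variable {R : Type u} {ar : R → ℕ} {C : Type v} {V : Type w}

/-- The facts obtained from a conjunction of constant-free atoms under an assignment. -/
def ground (e : V → C) (η : Finset (Atom ar V)) : Set (Fact ar C) :=
  {F | ∃ A ∈ η, F = A.map e}

namespace DisTGD

/-- Some body atom (a guard) contains all variables of the body. -/
def IsGuarded (τ : DisTGD ar V) : Prop :=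
  ∃ G ∈ τ.body, ∀ A ∈ τ.body, A.terms ⊆ G.terms

def bodyVars (τ : DisTGD ar V) : Set V := termsOf (τ.body : Set (Atom ar V))

/-- The existential variables of the head conjunction `η`. -/
def exVars (τ : DisTGD ar V) (η : Finset (Atom ar V)) : Set V :=
  termsOf (η : Set (Atom ar V)) \ τ.bodyVars

/-- `h` is a trigger for `τ` in `I` (only its values on the body variables matter). -/
def IsTrigger (τ : DisTGD ar V) (h : V → C) (I : Set (Fact ar C)) : Prop :=
  ground h τ.body ⊆ I

/-- `e` extends the trigger `h` by pairwise distinct fresh constants, not occurring in `I`, for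
the existential variables of `η`. -/
def IsFreshExtension (τ : DisTGD ar V) (η : Finset (Atom ar V)) (h e : V → C)
    (I : Set (Fact ar C)) : Prop :=
  Set.EqOn e h τ.bodyVars ∧ Set.InjOn e (τ.exVars η) ∧ ∀ y ∈ τ.exVars η, e y ∉ termsOf I

end DisTGD

end Dependencies

/-! ### Chase trees -/

/-- Finite trees of disjunctive chase steps. A step fires `τ` on `h`; it has one child for each
head conjunction `η` of `τ`, to which the extension `e η` of `h` is applied. Every step carries a
datum of type `δ`: `δ = Unit` for plain chase trees, `δ = Placement` for tree-like ones. -/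
inductive ChaseTree {R : Type u} (ar : R → ℕ) (C : Type v) (V : Type w) (δ : Type x)
  | leaf : ChaseTree ar C V δ
  | step (d : δ) (τ : DisTGD ar V) (h : V → C) (e : {η // η ∈ τ.head} → V → C)
      (children : {η // η ∈ τ.head} → ChaseTree ar C V δ) : ChaseTree ar C V δ

namespace ChaseTree

variable {R : Type u} {ar : R → ℕ} {C : Type v} {V : Type w} {δ : Type x}

/-- `T`, with `I` at its root, is a chase tree for `I` and `Sig` (oblivious chase). -/
def IsChaseTree (Sig : Set (DisTGD ar V)) : Set (Fact ar C) → ChaseTree ar C V δ → Prop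
  | _, leaf => True
  | I, step _ τ h e children =>
      τ ∈ Sig ∧ τ.IsTrigger h I ∧
        ∀ η : {η // η ∈ τ.head}, τ.IsFreshExtension η.1 h (e η) I ∧
          IsChaseTree Sig (I ∪ ground (e η) η.1) (children η)

/-- The instances at the leaves of the chase tree `T` with root instance `I`. -/
def leaves : Set (Fact ar C) → ChaseTree ar C V δ → Set (Set (Fact ar C))
  | I, leaf => {I}
  | I, step _ τ _ e children =>
      ⋃ η : {η // η ∈ τ.head}, leaves (I ∪ ground (e η) η.1) (children η)

/-- `T` is a chase proof of `Q` from `D` and `Sig`. -/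
def IsChaseProof (Sig : Set (DisTGD ar V)) (D : Set (Fact ar C)) (Q : UBCQ ar C V)
    (T : ChaseTree ar C V δ) : Prop :=
  T.IsChaseTree Sig D ∧ ∀ L ∈ T.leaves D, Q.Holds L

end ChaseTree

/-! ### Tree-like chases

The nodes of the tree into which an instance is decomposed are lists of natural numbers: the root
is `[]` and the children of `n` are the lists `k :: n`. So `m <:+ n` (`m` is a suffix of `n`) says
that `m` is a non-strict ancestor of `n`. -/

/-- A tree of bags of facts. -/
structure BagTree {R : Type u} (ar : R → ℕ) (C : Type v) where
  nodes : Set (List ℕ)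
  bag : List ℕ → Set (Fact ar C)

/-- How a chase step acts on the tree of bags: the node in which it is triggered, the name of the
child that is created where a non-full head conjunction is fired, and the nodes to which facts are
propagated afterwards. -/
structure Placement where
  node : List ℕ
  child : ℕ
  recipients : Set (List ℕ)

namespace BagTree

variable {R : Type u} {ar : R → ℕ} {C : Type v} {V : Type w}

/-- The tree whose single node is the root, with bag `I`. -/
def single (I : Set (Fact ar C)) : BagTree ar C where
  nodes := {[]}
  bag n := {F | n = [] ∧ F ∈ I}

/-- All facts of the tree. -/
def facts (S : BagTree ar C) : Set (Fact ar C) := {F | ∃ n ∈ S.nodes, F ∈ S.bag n}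

open Classical in
/-- Put new facts into the tree. A full head conjunction (one without existential variables) adds
them to the bag of the triggered node, a non-full one makes them the bag of a new child. -/
noncomputable def insertFacts (S : BagTree ar C) (d : Placement) (τ : DisTGD ar V)
    (η : Finset (Atom ar V)) (e : V → C) : BagTree ar C :=
  if τ.exVars η = ∅ then
    { nodes := S.nodes
      bag := Function.update S.bag d.node (S.bag d.node ∪ ground e η) }
  else
    { nodes := insert (d.child :: d.node) S.nodes
      bag := Function.update S.bag (d.child :: d.node) (ground e η) }

/-- Every node of `P` receives all facts of the tree that are guarded by a fact of its bag. -/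
def propagate (S : BagTree ar C) (P : Set (List ℕ)) : BagTree ar C where
  nodes := S.nodes
  bag n := S.bag n ∪
    {F | n ∈ P ∧ n ∈ S.nodes ∧ F ∈ S.facts ∧ ∃ G ∈ S.bag n, F.terms ⊆ G.terms}

/-- The tree of bags after a chase step, in the branch of the head conjunction `η`. -/
noncomputable def next (S : BagTree ar C) (d : Placement) (τ : DisTGD ar V)
    (η : Finset (Atom ar V)) (e : V → C) : BagTree ar C :=
  (S.insertFacts d τ η e).propagate d.recipients

/-- The subtree of the node `n` is the same in `S` and in `S'`. -/
def SameSubtree (n : List ℕ) (S S' : BagTree ar C) : Prop :=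
  ∀ m, n <:+ m → ((m ∈ S.nodes ↔ m ∈ S'.nodes) ∧ S.bag m = S'.bag m)

end BagTree

/-- A step of a thread of a tree-like chase tree: the trees of bags before and after it, and the
node in which it was triggered. -/
structure ThreadStep {R : Type u} (ar : R → ℕ) (C : Type v) where
  before : BagTree ar C
  node : List ℕ
  after : BagTree ar C

/-- The one-pass property of the sequence of steps of a thread: once a step has been triggered
outside of the subtree of a node `n` present at that stage, neither this step nor any later one
modifies the subtree of `n`. -/
def IsOnePassThread {R : Type u} {ar : R → ℕ} {C : Type v} (t : List (ThreadStep ar C)) : Prop :=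
  ∀ (n : List ℕ) (j k : Fin t.length), j ≤ k →
    n ∈ (t.get j).before.nodes → ¬ n <:+ (t.get j).node →
      BagTree.SameSubtree n (t.get k).before (t.get k).after

namespace ChaseTree

variable {R : Type u} {ar : R → ℕ} {C : Type v} {V : Type w}

/-- The placements of the steps of `T` are admissible, starting from the tree of bags `S`: each
step is triggered in a node whose bag contains the image of the body, the name of a new child is
unused, and facts are propagated at least to the new child and to all non-strict ancestors of the
triggered node (and possibly to more nodes; to all of them where `recipients = Set.univ`). -/
def WellPlaced : BagTree ar C → ChaseTree ar C V Placement → Prop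
  | _, leaf => True
  | S, step d τ h e children =>
      d.node ∈ S.nodes ∧ ground h τ.body ⊆ S.bag d.node ∧
      d.child :: d.node ∉ S.nodes ∧
      (∀ n, n <:+ d.child :: d.node → n ∈ d.recipients) ∧
        ∀ η : {η // η ∈ τ.head}, WellPlaced (S.next d τ η.1 (e η)) (children η)

/-- A tree-like chase tree for `I` and `Sig`. The tree of bags of its root is a single node. -/
def IsTreeLike (Sig : Set (DisTGD ar V)) (I : Set (Fact ar C))
    (T : ChaseTree ar C V Placement) : Prop :=
  T.IsChaseTree Sig I ∧ T.WellPlaced (BagTree.single I)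

/-- The threads (paths from the root to a leaf), as sequences of steps on trees of bags. -/
def threads : BagTree ar C → ChaseTree ar C V Placement → Set (List (ThreadStep ar C))
  | _, leaf => {[]}
  | S, step d τ _ e children =>
      {t | ∃ η : {η // η ∈ τ.head}, ∃ t' ∈ threads (S.next d τ η.1 (e η)) (children η),
        t = ⟨S, d.node, S.next d τ η.1 (e η)⟩ :: t'}

/-- A one-pass chase tree: a tree-like chase tree all of whose threads are one-pass. -/
def IsOnePass (Sig : Set (DisTGD ar V)) (I : Set (Fact ar C))
    (T : ChaseTree ar C V Placement) : Prop :=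
  T.IsTreeLike Sig I ∧ ∀ t ∈ T.threads (BagTree.single I), IsOnePassThread t

end ChaseTree

end DisChase

/-! Both claims reduce to `exists_onePass`: for every chase tree `T` there is a one-pass tree each
of whose leaves is the target of a homomorphism from some leaf of `T` fixing the constants of `D`.
Such homomorphisms preserve queries over `D`.

Building the one-pass tree is a game: the player chooses triggers, the opponent chooses head
disjuncts, and the player wants an instance in the set `W` of such targets. `Winning` positions
unfold into one-pass trees (`Winning.exists_chaseTree`), so it suffices that the root position is
winning.

Suppose it is losing. Each trigger in the current bag has a losing branch, and returning to an
ancestor keeps a position losing. Following such branches depth first yields a losing position whose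
root is complete to any prescribed depth (`Sound.exists_complete`). No subtree has to be re-entered:
a bag can gain only finitely many facts, so it is first made as large as losing positions allow
(`Sound.exists_stable`). While it no longer changes, the subtrees already left below it stay
complete, because any outside fact guarded by a bag in them is already in the parent's bag
(`Complete.transfer`). Now `T` can be followed into this tree of bags, each step consuming one level
of depth and taking the disjunct that is realised there (`exists_hom`). So a leaf of `T` maps into
the instance of a losing position; this instance lies in `W`, a contradiction.

`D` and `Sig` may be infinite. Finiteness comes from using only the rules of `T`, and only triggers
into a set `K` of constants that meets every bag in finitely many of them. -/

namespace DisChase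

universe u v w x

/-! ### Terms of atoms, fresh constants and finiteness. -/

section Basics

variable {R : Type u} {ar : R → ℕ} {C : Type v} {V : Type w}

theorem Atom.terms_map {T : Type v} {T' : Type w} (f : T → T') (A : Atom ar T) :
    (A.map f).terms = f '' A.terms := by
  unfold Atom.terms Atom.map
  exact Set.range_comp f A.args

theorem Atom.map_map {T T' T'' : Type*} (f : T → T') (g : T' → T'') (A : Atom ar T) :
    (A.map f).map g = A.map (g ∘ f) := rfl

theorem Atom.map_congr {T : Type v} {T' : Type w} {f g : T → T'} {A : Atom ar T}
    (h : Set.EqOn f g A.terms) : A.map f = A.map g := by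
  unfold Atom.map
  congr 1
  funext i
  exact h ⟨i, rfl⟩

theorem termsOf_mono {T : Type v} {S S' : Set (Atom ar T)} (h : S ⊆ S') :
    termsOf S ⊆ termsOf S' := fun _ ⟨A, hA, ht⟩ => ⟨A, h hA, ht⟩

theorem termsOf_union {T : Type v} (S S' : Set (Atom ar T)) :
    termsOf (S ∪ S') = termsOf S ∪ termsOf S' := by
  ext t
  constructor
  · rintro ⟨A, hA | hA, ht⟩
    · exact Or.inl ⟨A, hA, ht⟩
    · exact Or.inr ⟨A, hA, ht⟩
  · rintro (⟨A, hA, ht⟩ | ⟨A, hA, ht⟩)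
    · exact ⟨A, Or.inl hA, ht⟩
    · exact ⟨A, Or.inr hA, ht⟩

theorem finite_termsOf {T : Type v} (η : Finset (Atom ar T)) :
    (termsOf (η : Set (Atom ar T))).Finite := by
  have : termsOf (η : Set (Atom ar T)) = ⋃ A ∈ (η : Set (Atom ar T)), A.terms := by
    ext t
    simp [termsOf]
  rw [this]
  exact η.finite_toSet.biUnion fun A _ => Set.finite_range A.args

theorem termsOf_ground (e : V → C) (η : Finset (Atom ar V)) :
    termsOf (ground e η) = e '' termsOf (η : Set (Atom ar V)) := by
  ext t
  constructor
  · rintro ⟨_, ⟨A, hA, rfl⟩, ht⟩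
    rw [Atom.terms_map] at ht
    obtain ⟨y, hy, rfl⟩ := ht
    exact ⟨y, ⟨A, hA, hy⟩, rfl⟩
  · rintro ⟨y, ⟨A, hA, hy⟩, rfl⟩
    exact ⟨A.map e, ⟨A, hA, rfl⟩, by rw [Atom.terms_map]; exact ⟨y, hy, rfl⟩⟩

theorem DisTGD.terms_subset (τ : DisTGD ar V) (η : Finset (Atom ar V)) :
    termsOf (η : Set (Atom ar V)) ⊆ τ.bodyVars ∪ τ.exVars η := by
  intro y hy
  by_cases h : y ∈ τ.bodyVars
  · exact Or.inl h
  · exact Or.inr ⟨hy, h⟩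

/-- The terms of an instantiated head conjunction come from the trigger or are fresh. -/
theorem DisTGD.IsFreshExtension.mem_cases {τ : DisTGD ar V} {η : Finset (Atom ar V)}
    {h e : V → C} {I : Set (Fact ar C)} (he : τ.IsFreshExtension η h e I) {x : C}
    (hx : x ∈ termsOf (ground e η)) :
    (∃ y ∈ τ.bodyVars, h y = x) ∨ (x ∉ termsOf I ∧ τ.exVars η ≠ ∅) := by
  rw [termsOf_ground] at hx
  obtain ⟨y, hy, rfl⟩ := hx
  rcases τ.terms_subset η hy with hb | hb
  · exact Or.inl ⟨y, hb, (he.1 hb).symm⟩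
  · exact Or.inr ⟨he.2.2 y hb, (Set.nonempty_iff_ne_empty.1 ⟨y, hb⟩)⟩

theorem DisTGD.exists_freshExtension (τ : DisTGD ar V) (η : Finset (Atom ar V)) (h : V → C)
    {I : Set (Fact ar C)} (hI : (termsOf I)ᶜ.Infinite) :
    ∃ e, τ.IsFreshExtension η h e I := by
  classical
  have hfin : (τ.exVars η).Finite := (finite_termsOf η).subset Set.sdiff_subset
  have : Finite (τ.exVars η) := hfin
  have : Infinite ((termsOf I)ᶜ : Set C) := hI.to_subtype
  obtain ⟨n, ⟨f⟩⟩ := Finite.exists_equiv_fin (τ.exVars η)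
  let g := Infinite.natEmbedding ((termsOf I)ᶜ : Set C)
  refine ⟨fun y => if hy : y ∈ τ.exVars η then g (f ⟨y, hy⟩) else h y, ?_, ?_, ?_⟩
  · intro y hy
    have : y ∉ τ.exVars η := fun h' => h'.2 hy
    simp [this]
  · intro y hy z hz hyz
    simp only [hy, hz, dif_pos] at hyz
    have := f.injective (Fin.ext (g.injective (Subtype.ext hyz)))
    simpa using this
  · intro y hy
    simp only [hy, dif_pos]
    exact (g (f ⟨y, hy⟩)).2

/-- This bounds the facts that a bag can gain, and hence makes stable bags possible. -/
theorem finite_facts_over {A : Set R} (hA : A.Finite) {X : Set C} (hX : X.Finite) :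
    {F : Fact ar C | F.rel ∈ A ∧ F.terms ⊆ X}.Finite := by
  have : {F : Fact ar C | F.rel ∈ A ∧ F.terms ⊆ X} ⊆
      ⋃ r ∈ A, (fun a : Fin (ar r) → C => (⟨r, a⟩ : Fact ar C)) '' Set.pi Set.univ fun _ => X := by
    rintro ⟨r, a⟩ ⟨hr, ha⟩
    refine Set.mem_biUnion hr ⟨a, fun i _ => ha ⟨i, rfl⟩, rfl⟩
  exact (hA.biUnion fun r _ => (Set.Finite.pi' fun _ => hX).image _ |>.subset (by
    rintro _ ⟨a, ha, rfl⟩; exact ⟨a, fun i => ha i trivial, rfl⟩)).subset this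

/-- The relations occurring in the heads of a set of dependencies. -/
def headRels (Sig : Set (DisTGD ar V)) : Set R :=
  {r | ∃ τ ∈ Sig, ∃ η ∈ τ.head, ∃ A ∈ η, A.rel = r}

theorem finite_headRels {Sig : Set (DisTGD ar V)} (h : Sig.Finite) : (headRels Sig).Finite := by
  have : headRels Sig ⊆ ⋃ τ ∈ Sig, ⋃ η ∈ (τ.head : Set (Finset (Atom ar V))),
      Atom.rel '' (η : Set (Atom ar V)) := by
    rintro r ⟨τ, hτ, η, hη, A, hA, rfl⟩
    exact Set.mem_biUnion hτ (Set.mem_biUnion hη ⟨A, hA, rfl⟩)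
  exact (h.biUnion fun τ _ => τ.head.finite_toSet.biUnion fun η _ =>
    η.finite_toSet.image _).subset this

end Basics

/-! ### Steps that propagate only along a branch -/

namespace BagTree

variable {R : Type u} {ar : R → ℕ} {C : Type v} {V : Type w}

/-- The bag of `n` contains all facts of the tree that it guards. -/
def Closed (S : BagTree ar C) (n : List ℕ) : Prop :=
  ∀ F ∈ S.facts, ∀ G ∈ S.bag n, F.terms ⊆ G.terms → F ∈ S.bag n

open Classical in
/-- The node into which a step triggered in `u` puts the new facts. -/
noncomputable def focus (τ : DisTGD ar V) (η : Finset (Atom ar V)) (u : List ℕ) (k : ℕ) :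
    List ℕ :=
  if τ.exVars η = ∅ then u else k :: u

/-- The tree after a step triggered in `u`, where facts are propagated only to the ancestors of
`u` and to the new child. -/
noncomputable def advance (S : BagTree ar C) (u : List ℕ) (k : ℕ) (τ : DisTGD ar V)
    (η : Finset (Atom ar V)) (e : V → C) : BagTree ar C :=
  S.next ⟨u, k, {n | n <:+ k :: u}⟩ τ η e

theorem focus_cases (τ : DisTGD ar V) (η : Finset (Atom ar V)) (u : List ℕ) (k : ℕ) :
    (τ.exVars η = ∅ ∧ focus τ η u k = u) ∨ (τ.exVars η ≠ ∅ ∧ focus τ η u k = k :: u) := by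
  unfold focus
  split_ifs with h
  · exact Or.inl ⟨h, rfl⟩
  · exact Or.inr ⟨h, rfl⟩

theorem focus_suffix (τ : DisTGD ar V) (η : Finset (Atom ar V)) (u : List ℕ) (k : ℕ) :
    focus τ η u k <:+ k :: u := by
  rcases focus_cases τ η u k with ⟨-, h⟩ | ⟨-, h⟩ <;> rw [h]
  exact List.suffix_cons k u

variable {S : BagTree ar C} {u : List ℕ} {k : ℕ} {τ : DisTGD ar V} {η : Finset (Atom ar V)}
  {e : V → C}

theorem bag_subset_facts {n : List ℕ} (hn : n ∈ S.nodes) : S.bag n ⊆ S.facts :=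
  fun _ hF => ⟨n, hn, hF⟩

theorem facts_single (I : Set (Fact ar C)) : (single I).facts = I := by
  ext F
  simp [facts, single]

theorem facts_propagate (P : Set (List ℕ)) : (S.propagate P).facts = S.facts := by
  ext F
  constructor
  · rintro ⟨n, hn, hF | ⟨-, -, hF, -⟩⟩
    · exact ⟨n, hn, hF⟩
    · exact hF
  · rintro ⟨n, hn, hF⟩
    exact ⟨n, hn, Or.inl hF⟩

theorem propagate_closed (P : Set (List ℕ)) {n : List ℕ} (hn : n ∈ S.nodes) (hP : n ∈ P) :
    (S.propagate P).Closed n := by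
  intro F hF G hG hFG
  rw [facts_propagate] at hF
  rcases hG with hG | ⟨-, -, -, G', hG', hGG'⟩
  · exact Or.inr ⟨hP, hn, hF, G, hG, hFG⟩
  · exact Or.inr ⟨hP, hn, hF, G', hG', hFG.trans hGG'⟩

theorem termsOf_propagate (P : Set (List ℕ)) (n : List ℕ) :
    termsOf ((S.propagate P).bag n) = termsOf (S.bag n) := by
  apply Set.Subset.antisymm
  · rintro t ⟨F, hF | ⟨-, -, -, G, hG, hFG⟩, ht⟩
    · exact ⟨F, hF, ht⟩
    · exact ⟨G, hG, hFG ht⟩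
  · exact termsOf_mono fun F hF => Or.inl hF

/-- Insertion of facts in terms of the focus of the step. -/
theorem insertFacts_spec (d : Placement) (hd : d.node ∈ S.nodes) :
    (S.insertFacts d τ η e).nodes = insert (focus τ η d.node d.child) S.nodes ∧
      (S.insertFacts d τ η e).bag = Function.update S.bag (focus τ η d.node d.child)
        ({F | τ.exVars η = ∅ ∧ F ∈ S.bag d.node} ∪ ground e η) := by
  unfold insertFacts
  rcases focus_cases τ η d.node d.child with ⟨h, h'⟩ | ⟨h, h'⟩
  · rw [h', if_pos h]
    refine ⟨(Set.insert_eq_of_mem hd).symm, ?_⟩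
    simp [h]
  · rw [h', if_neg h]
    refine ⟨rfl, ?_⟩
    simp [h]

theorem advance_nodes (hu : u ∈ S.nodes) :
    (S.advance u k τ η e).nodes = insert (focus τ η u k) S.nodes :=
  (insertFacts_spec (τ := τ) (η := η) (e := e) ⟨u, k, {n | n <:+ k :: u}⟩ hu).1

theorem focus_mem_advance (hu : u ∈ S.nodes) : focus τ η u k ∈ (S.advance u k τ η e).nodes := by
  rw [advance_nodes hu]
  exact Set.mem_insert _ _

theorem nodes_subset_advance (hu : u ∈ S.nodes) : S.nodes ⊆ (S.advance u k τ η e).nodes := by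
  rw [advance_nodes hu]
  exact Set.subset_insert _ _

theorem ground_subset_advance (hu : u ∈ S.nodes) :
    ground e η ⊆ (S.advance u k τ η e).bag (focus τ η u k) := by
  intro F hF
  left
  rw [(insertFacts_spec _ hu).2]
  simp [hF]

theorem ne_focus_or {n : List ℕ} (hk : k :: u ∉ S.nodes) (hn : n ∈ S.nodes)
    (h : n = focus τ η u k) : τ.exVars η = ∅ ∧ n = u := by
  rcases focus_cases τ η u k with ⟨h1, h2⟩ | ⟨h1, h2⟩
  · exact ⟨h1, h.trans h2⟩
  · exact absurd (h2 ▸ h ▸ hn) hk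

theorem bag_subset_advance (hu : u ∈ S.nodes) (hk : k :: u ∉ S.nodes) {n : List ℕ}
    (hn : n ∈ S.nodes) : S.bag n ⊆ (S.advance u k τ η e).bag n := by
  intro F hF
  left
  rw [(insertFacts_spec _ hu).2]
  by_cases h : n = focus τ η u k
  · obtain ⟨h1, rfl⟩ := ne_focus_or hk hn h
    rw [← h]
    simp [h1, hF]
  · simp [Function.update_of_ne h, hF]

theorem advance_bag_eq (hu : u ∈ S.nodes) {n : List ℕ} (hn : ¬ n <:+ k :: u) :
    (S.advance u k τ η e).bag n = S.bag n := by
  have h : n ≠ focus τ η u k := fun h => hn (h ▸ focus_suffix τ η u k)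
  ext F
  change (F ∈ (insertFacts _ _ _ _ _).bag n ∨ _) ↔ _
  rw [(insertFacts_spec _ hu).2, Function.update_of_ne h]
  simp [hn]

theorem facts_advance (hu : u ∈ S.nodes) (hk : k :: u ∉ S.nodes) :
    (S.advance u k τ η e).facts = S.facts ∪ ground e η := by
  apply Set.Subset.antisymm
  · rw [advance, next, facts_propagate]
    rintro F ⟨n, hn, hF⟩
    rw [(insertFacts_spec _ hu).1] at hn
    rw [(insertFacts_spec _ hu).2] at hF
    by_cases h : n = focus τ η u k
    · subst h
      rw [Function.update_self] at hF
      rcases hF with ⟨-, hF⟩ | hF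
      · exact Or.inl ⟨u, hu, hF⟩
      · exact Or.inr hF
    · rw [Function.update_of_ne h] at hF
      exact Or.inl ⟨n, hn.resolve_left h, hF⟩
  · rintro F (⟨n, hn, hF⟩ | hF)
    · exact ⟨n, nodes_subset_advance hu hn, bag_subset_advance hu hk hn hF⟩
    · exact ⟨_, focus_mem_advance hu, ground_subset_advance hu hF⟩

theorem advance_closed {n : List ℕ} (hn : n <:+ k :: u)
    (hn' : n ∈ (S.advance u k τ η e).nodes) : (S.advance u k τ η e).Closed n :=
  propagate_closed _ hn' hn

theorem termsOf_advance_focus (hu : u ∈ S.nodes) (h : τ.exVars η ≠ ∅) :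
    termsOf ((S.advance u k τ η e).bag (k :: u)) = termsOf (ground e η) := by
  rw [advance, next, termsOf_propagate, (insertFacts_spec _ hu).2]
  rcases focus_cases τ η u k with ⟨h1, h2⟩ | ⟨h1, h2⟩
  · exact absurd h1 h
  · rw [h2]
    simp [h]

/-- A step does not enlarge the sets of constants guarded in the bag of an existing node. -/
theorem exists_guard_of_advance (hu : u ∈ S.nodes) (hk : k :: u ∉ S.nodes) (hτ : τ.IsGuarded)
    {h : V → C} (hb : ground h τ.body ⊆ S.bag u) (he : τ.IsFreshExtension η h e S.facts)
    {n : List ℕ} (hn : n ∈ S.nodes) {F : Fact ar C} (hF : F ∈ (S.advance u k τ η e).bag n) :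
    ∃ G ∈ S.bag n, F.terms ⊆ G.terms := by
  have key : ∀ F ∈ (S.insertFacts ⟨u, k, {n | n <:+ k :: u}⟩ τ η e).bag n,
      ∃ G ∈ S.bag n, F.terms ⊆ G.terms := by
    intro F hF
    rw [(insertFacts_spec _ hu).2] at hF
    by_cases h' : n = focus τ η u k
    · obtain ⟨h1, h2⟩ := ne_focus_or hk hn h'
      subst h2
      rw [← h', Function.update_self] at hF
      rcases hF with ⟨-, hF⟩ | hF
      · exact ⟨F, hF, subset_rfl⟩
      · obtain ⟨G, hG, hG'⟩ := hτ
        refine ⟨G.map h, hb ⟨G, hG, rfl⟩, fun x hx => ?_⟩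
        rcases he.mem_cases ⟨F, hF, hx⟩ with ⟨y, ⟨A, hA, hy⟩, rfl⟩ | ⟨-, h2⟩
        · rw [Atom.terms_map]
          exact ⟨y, hG' A hA hy, rfl⟩
        · exact absurd h1 h2
    · rw [Function.update_of_ne h'] at hF
      exact ⟨F, hF, subset_rfl⟩
  rcases hF with hF | ⟨-, -, -, G, hG, hFG⟩
  · exact key F hF
  · obtain ⟨G', hG', hGG'⟩ := key G hG
    exact ⟨G', hG', hFG.trans hGG'⟩

theorem termsOf_advance (hu : u ∈ S.nodes) (hk : k :: u ∉ S.nodes) (hτ : τ.IsGuarded) {h : V → C}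
    (hb : ground h τ.body ⊆ S.bag u) (he : τ.IsFreshExtension η h e S.facts) {n : List ℕ}
    (hn : n ∈ S.nodes) : termsOf ((S.advance u k τ η e).bag n) = termsOf (S.bag n) := by
  apply Set.Subset.antisymm
  · rintro x ⟨F, hF, hx⟩
    obtain ⟨G, hG, hFG⟩ := exists_guard_of_advance hu hk hτ hb he hn hF
    exact ⟨G, hG, hFG hx⟩
  · exact termsOf_mono (bag_subset_advance hu hk hn)

/-- A step does not modify subtrees that do not contain the node in which it is triggered. -/
theorem sameSubtree_advance (hu : u ∈ S.nodes) {n : List ℕ}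
    (hn : n ∈ S.nodes) (hk : k :: u ∉ S.nodes) (hnu : ¬ n <:+ u) :
    SameSubtree n S (S.advance u k τ η e) := by
  have hnk : ¬ n <:+ k :: u := by
    intro h
    rcases List.suffix_cons_iff.1 h with h | h
    · exact hk (h ▸ hn)
    · exact hnu h
  intro m hm
  have hmk : ¬ m <:+ k :: u := fun h => hnk (hm.trans h)
  refine ⟨?_, (advance_bag_eq hu hmk).symm⟩
  rw [advance_nodes hu]
  have : m ≠ focus τ η u k := fun h => hmk (h ▸ focus_suffix τ η u k)
  simp [this]

theorem not_suffix_focus {n : List ℕ} (hn : n ∈ S.nodes) (hk : k :: u ∉ S.nodes)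
    (hnu : ¬ n <:+ u) : ¬ n <:+ focus τ η u k := by
  intro h
  rcases List.suffix_cons_iff.1 (h.trans (focus_suffix τ η u k)) with h | h
  · exact hk (h ▸ hn)
  · exact hnu h

end BagTree

/-! ### One-pass continuations -/

section Winning

variable {R : Type u} {ar : R → ℕ} {C : Type v} {V : Type w}

open BagTree

/-- From the tree of bags `S` one can force an instance in `W` by steps triggered in `v`, in one
of its ancestors, or below nodes created by such steps, never returning to a subtree once it has
been left. -/
inductive Winning (Sig : Set (DisTGD ar V)) (W : Set (Set (Fact ar C))) :
    BagTree ar C → List ℕ → Prop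
  | leaf {S : BagTree ar C} {v : List ℕ} (h : S.facts ∈ W) : Winning Sig W S v
  | step {S : BagTree ar C} {v u : List ℕ} {k : ℕ} {τ : DisTGD ar V} {h : V → C}
      (e : {η // η ∈ τ.head} → V → C) (huv : u <:+ v) (hu : u ∈ S.nodes) (hk : k :: u ∉ S.nodes)
      (hτ : τ ∈ Sig) (hb : ground h τ.body ⊆ S.bag u)
      (he : ∀ η, τ.IsFreshExtension η.1 h (e η) S.facts)
      (hw : ∀ η, Winning Sig W (S.advance u k τ η.1 (e η)) (focus τ η.1 u k)) :
      Winning Sig W S v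

/-- A deeper current node only enlarges the choice of nodes to trigger in. In contrapositive form:
returning to an ancestor keeps a losing position losing. -/
theorem Winning.of_suffix {Sig : Set (DisTGD ar V)} {W : Set (Set (Fact ar C))}
    {S : BagTree ar C} {u v : List ℕ} (h : Winning Sig W S u) (huv : u <:+ v) :
    Winning Sig W S v := by
  cases h with
  | leaf h => exact .leaf h
  | step e hu hu' hk hτ hb he hw => exact .step e (hu.trans huv) hu' hk hτ hb he hw

/-- The last clause strengthens the induction: subtrees off the branch of `v` are never modified.
Applied to the children of a step, it gives the one-pass property relative to that step. -/
theorem Winning.exists_chaseTree {Sig : Set (DisTGD ar V)} {W : Set (Set (Fact ar C))}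
    {S : BagTree ar C} {v : List ℕ} (h : Winning Sig W S v) :
    ∃ T : ChaseTree ar C V Placement, T.IsChaseTree Sig S.facts ∧ T.WellPlaced S ∧
      (∀ L ∈ T.leaves S.facts, L ∈ W) ∧
      ∀ t ∈ T.threads S, IsOnePassThread t ∧
        ∀ n ∈ S.nodes, ¬ n <:+ v → ∀ s ∈ t, SameSubtree n s.before s.after := by
  induction h with
  | leaf h =>
    refine ⟨.leaf, trivial, trivial, fun L hL => hL ▸ h, ?_⟩
    rintro t rfl
    exact ⟨fun n j => j.elim0, fun n _ _ s hs => absurd hs List.not_mem_nil⟩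
  | @step S v u k τ h e huv hu hk hτ hb he hw ih =>
    choose T hT hP hL ht using ih
    have hsub : u <:+ k :: u := List.suffix_cons k u
    refine ⟨.step ⟨u, k, {n | n <:+ k :: u}⟩ τ h e T,
      ⟨hτ, hb.trans (bag_subset_facts hu), fun η => ⟨he η, ?_⟩⟩,
      ⟨hu, hb, hk, fun n hn => hn, fun η => hP η⟩, ?_, ?_⟩
    · rw [← facts_advance hu hk]
      exact hT η
    · intro L hL'
      obtain ⟨η, hη⟩ := Set.mem_iUnion.1 hL'
      rw [← facts_advance hu hk] at hη
      exact hL η L hη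
    · rintro _ ⟨η, t, htη, rfl⟩
      obtain ⟨h1, h2⟩ := ht η t htη
      have frozen : ∀ n ∈ S.nodes, ¬ n <:+ u → ∀ s ∈ t, SameSubtree n s.before s.after :=
        fun n hn hnu => h2 n (nodes_subset_advance hu hn) (not_suffix_focus hn hk hnu)
      constructor
      · rintro n ⟨j, hj⟩ ⟨l, hl⟩ hjl hn hnj
        -- Index `0` is the present step; for `j = 0 < l` the subtree was left now and is frozen in
        -- the rest of the thread.
        match j, l with
        | 0, 0 => exact sameSubtree_advance hu hn hk hnj
        | 0, l + 1 => exact frozen n hn hnj _ (List.getElem_mem _)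
        | j + 1, 0 => exact absurd hjl (by simp)
        | j + 1, l + 1 =>
          exact h1 n ⟨j, Nat.lt_of_succ_lt_succ hj⟩ ⟨l, Nat.lt_of_succ_lt_succ hl⟩
            (Nat.le_of_succ_le_succ hjl) hn hnj
      · intro n hn hnv s hs
        have hnu : ¬ n <:+ u := fun h => hnv (h.trans huv)
        rcases List.mem_cons.1 hs with rfl | hs
        · exact sameSubtree_advance hu hn hk hnu
        · exact frozen n hn hnu s hs

end Winning

/-! ### Losing positions -/

section Game

variable {R : Type u} {ar : R → ℕ} {C : Type v} {V : Type w}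

open BagTree

/-- A tree of bags with the node that is currently processed. -/
abbrev Position {R : Type u} (ar : R → ℕ) (C : Type v) := BagTree ar C × List ℕ

/-- Moves between positions: return to an ancestor, or perform a step with a rule in `Sig`
triggered on constants in `K`, in some branch of the step. -/
inductive Move (Sig : Set (DisTGD ar V)) (K : Set C) : Position ar C → Position ar C → Prop
  | pop {S : BagTree ar C} {u v : List ℕ} (huv : u <:+ v) : Move Sig K (S, v) (S, u)
  | step {S : BagTree ar C} {v : List ℕ} {k : ℕ} {τ : DisTGD ar V} {η : Finset (Atom ar V)}
      {h e : V → C} (hk : k :: v ∉ S.nodes) (hτ : τ ∈ Sig)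
      (hb : ground h τ.body ⊆ S.bag v) (hK : ∀ y ∈ τ.bodyVars, h y ∈ K) (hη : η ∈ τ.head)
      (he : τ.IsFreshExtension η h e S.facts) :
      Move Sig K (S, v) (S.advance v k τ η e, focus τ η v k)

/-- Invariants of the positions reached from the root position. -/
structure Sound (K : Set C) (S : BagTree ar C) (v : List ℕ) : Prop where
  mem : v ∈ S.nodes
  parent_mem : ∀ k n, k :: n ∈ S.nodes → n ∈ S.nodes
  finite_nodes : S.nodes.Finite
  infinite_fresh : (termsOf S.facts)ᶜ.Infinite
  -- Together with `finite_terms`: existential constants always lie in `K`, yet each bag contains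
  -- only finitely many members of `K`, even if `D` is infinite.
  fresh_mem : (termsOf S.facts)ᶜ ⊆ K
  finite_terms : ∀ n ∈ S.nodes, (termsOf (S.bag n) ∩ K).Finite
  closed : ∀ n, n <:+ v → S.Closed n
  -- The constants that a subtree's root bag shares with the outside lie in one fact of the parent
  -- bag. This is where guardedness enters the tree structure.
  guard : ∀ k n, k :: n ∈ S.nodes → ∃ G ∈ S.bag n, ∀ x ∈ termsOf (S.bag (k :: n)),
    ∀ m ∈ S.nodes, ¬ k :: n <:+ m → x ∈ termsOf (S.bag m) → x ∈ G.terms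

variable {Sig : Set (DisTGD ar V)} {K : Set C}

theorem Sound.suffix_mem {S : BagTree ar C} {v : List ℕ} (h : Sound K S v) {m n : List ℕ}
    (hmn : m <:+ n) (hn : n ∈ S.nodes) : m ∈ S.nodes := by
  induction n with
  | nil => rwa [List.suffix_nil.1 hmn]
  | cons k n ih =>
    rcases List.suffix_cons_iff.1 hmn with rfl | h'
    · exact hn
    · exact ih h' (h.parent_mem k n hn)

theorem Sound.advance (hSig : ∀ τ ∈ Sig, τ.IsGuarded) {S : BagTree ar C} {v : List ℕ}
    (hS : Sound K S v) {k : ℕ} {τ : DisTGD ar V} {η : Finset (Atom ar V)} {h e : V → C}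
    (hk : k :: v ∉ S.nodes) (hτ : τ ∈ Sig) (hb : ground h τ.body ⊆ S.bag v)
    (he : τ.IsFreshExtension η h e S.facts) :
    Sound K (S.advance v k τ η e) (focus τ η v k) := by
  have hv : v ∈ S.nodes := hS.mem
  have hnodes : (S.advance v k τ η e).nodes = insert (focus τ η v k) S.nodes :=
    advance_nodes hv
  have hfacts := facts_advance (τ := τ) (η := η) (e := e) hv hk
  have hterms : ∀ n ∈ S.nodes, termsOf ((S.advance v k τ η e).bag n) = termsOf (S.bag n) :=
    fun n hn => termsOf_advance hv hk (hSig τ hτ) hb he hn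
  have hnew : ∀ n ∈ (S.advance v k τ η e).nodes,
      n ∈ S.nodes ∨ (τ.exVars η ≠ ∅ ∧ n = k :: v) := by
    intro n hn
    rw [hnodes] at hn
    rcases hn with rfl | hn
    · rcases focus_cases τ η v k with ⟨h1, h2⟩ | ⟨h1, h2⟩
      · exact Or.inl (by rw [h2]; exact hv)
      · exact Or.inr ⟨h1, h2⟩
    · exact Or.inl hn
  have hgfin : (termsOf (ground e η)).Finite := by
    rw [termsOf_ground]
    exact (finite_termsOf η).image e
  have hbody : ∀ y ∈ τ.bodyVars, h y ∈ termsOf (S.bag v) := by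
    intro y hy
    apply termsOf_mono hb
    rw [termsOf_ground]
    exact ⟨y, hy, rfl⟩
  have hchild : τ.exVars η ≠ ∅ →
      termsOf ((S.advance v k τ η e).bag (k :: v)) = termsOf (ground e η) :=
    fun h1 => termsOf_advance_focus hv h1
  have hparent : ∀ k' n, k' :: n ∈ (S.advance v k τ η e).nodes →
      n ∈ (S.advance v k τ η e).nodes := by
    intro k' n hn
    apply nodes_subset_advance hv
    rcases hnew _ hn with hn | ⟨-, hn⟩
    · exact hS.parent_mem _ _ hn
    · obtain ⟨-, rfl⟩ := List.cons.inj hn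
      exact hv
  refine ⟨focus_mem_advance hv, hparent, ?_, ?_, ?_, ?_, ?_, ?_⟩
  · rw [hnodes]
    exact hS.finite_nodes.insert _
  · rw [hfacts, termsOf_union, Set.compl_union, ← Set.sdiff_eq]
    exact hS.infinite_fresh.sdiff hgfin
  · refine Set.Subset.trans (Set.compl_subset_compl.2 (termsOf_mono ?_)) hS.fresh_mem
    rw [hfacts]
    exact Set.subset_union_left
  · intro n hn
    rcases hnew n hn with hn | ⟨h1, rfl⟩
    · rw [hterms n hn]
      exact hS.finite_terms n hn
    · rw [hchild h1]
      exact hgfin.inter_of_left K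
  · intro n hn
    refine advance_closed (hn.trans (focus_suffix τ η v k)) ?_
    rw [hnodes]
    rcases focus_cases τ η v k with ⟨h1, h2⟩ | ⟨h1, h2⟩
    · rw [h2] at hn
      exact Or.inr (hS.suffix_mem hn hv)
    · rw [h2] at hn ⊢
      rcases List.suffix_cons_iff.1 hn with rfl | hn
      · exact Or.inl rfl
      · exact Or.inr (hS.suffix_mem hn hv)
  · intro k' n hn
    rcases hnew _ hn with hn' | ⟨h1, hn'⟩
    · obtain ⟨G, hG, hx⟩ := hS.guard k' n hn'
      refine ⟨G, bag_subset_advance hv hk (hS.parent_mem _ _ hn') hG, ?_⟩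
      intro x hxn m hm hnm hxm
      rw [hterms _ hn'] at hxn
      rcases hnew m hm with hm | ⟨h1, rfl⟩
      · rw [hterms m hm] at hxm
        exact hx x hxn m hm hnm hxm
      · rw [hchild h1] at hxm
        -- A constant of the new bag that is also old comes from the trigger, so it already occurs
        -- in `v`, which is outside the subtree of `k' :: n` as well.
        rcases he.mem_cases hxm with ⟨y, hy, rfl⟩ | ⟨h2, -⟩
        · exact hx _ hxn v hv (fun h' => hnm (h'.trans (List.suffix_cons k v))) (hbody y hy)
        · exact absurd (termsOf_mono (bag_subset_facts hn') hxn) h2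
    · obtain ⟨rfl, rfl⟩ := List.cons.inj hn'
      -- At the new child the image of the rule's guard is the witness: constants not from the
      -- trigger are fresh and occur nowhere else.
      obtain ⟨G, hG, hG'⟩ := hSig τ hτ
      refine ⟨G.map h, bag_subset_advance hv hk hv (hb ⟨G, hG, rfl⟩), ?_⟩
      intro x hxn m hm hnm hxm
      rw [hchild h1] at hxn
      rcases hnew m hm with hm | ⟨-, rfl⟩
      · rw [hterms m hm] at hxm
        rcases he.mem_cases hxn with ⟨y, ⟨A, hA, hy⟩, rfl⟩ | ⟨h2, -⟩
        · rw [Atom.terms_map]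
          exact ⟨y, hG' A hA hy, rfl⟩
        · exact absurd (termsOf_mono (bag_subset_facts hm) hxm) h2
      · exact absurd List.suffix_rfl hnm

/-- Positions reachable by moves. -/
abbrev Reach (Sig : Set (DisTGD ar V)) (K : Set C) : Position ar C → Position ar C → Prop :=
  Relation.ReflTransGen (Move Sig K)

theorem Reach.sound (hSig : ∀ τ ∈ Sig, τ.IsGuarded) {p q : Position ar C} (h : Reach Sig K p q)
    (hp : Sound K p.1 p.2) : Sound K q.1 q.2 := by
  induction h with
  | refl => exact hp
  | tail _ hm ih =>
    cases hm with
    | pop huv =>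
      exact { ih with
        mem := ih.suffix_mem huv ih.mem
        closed := fun n hn => ih.closed n (hn.trans huv) }
    | step hk hτ hb hK hη he => exact ih.advance hSig hk hτ hb he

/-- Moves do not modify the subtrees that have been left. -/
theorem Reach.frozen (hSig : ∀ τ ∈ Sig, τ.IsGuarded) {p q : Position ar C} (h : Reach Sig K p q)
    (hp : Sound K p.1 p.2) {n : List ℕ} (hn : n ∈ p.1.nodes) (hnp : ¬ n <:+ p.2) :
    SameSubtree n p.1 q.1 ∧ ¬ n <:+ q.2 := by
  induction h with
  | refl => exact ⟨fun m _ => ⟨Iff.rfl, rfl⟩, hnp⟩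
  | tail hr hm ih =>
    have hs := Reach.sound hSig hr hp
    cases hm with
    | pop huv => exact ⟨ih.1, fun h => ih.2 (h.trans huv)⟩
    | @step S v k τ η h e hk hτ hb hK hη he =>
      have hn' : n ∈ S.nodes := (ih.1 n List.suffix_rfl).1.1 hn
      have hsame := sameSubtree_advance (τ := τ) (η := η) (e := e) hs.mem hn' hk ih.2
      exact ⟨fun m hm => ⟨(ih.1 m hm).1.trans (hsame m hm).1, (ih.1 m hm).2.trans (hsame m hm).2⟩,
        not_suffix_focus hn' hk ih.2⟩

/-- The facts that moves can add. -/
def newFacts (Sig : Set (DisTGD ar V)) (K : Set C) : Set (Fact ar C) :=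
  {F | F.rel ∈ headRels Sig ∧ F.terms ⊆ K}

theorem ground_subset_newFacts {S : BagTree ar C} {v : List ℕ} (hS : Sound K S v)
    {τ : DisTGD ar V} {η : Finset (Atom ar V)} {h e : V → C} (hτ : τ ∈ Sig)
    (hK : ∀ y ∈ τ.bodyVars, h y ∈ K) (hη : η ∈ τ.head)
    (he : τ.IsFreshExtension η h e S.facts) : ground e η ⊆ newFacts Sig K := by
  rintro F hF
  constructor
  · obtain ⟨A, hA, rfl⟩ := hF
    exact ⟨τ, hτ, η, hη, A, hA, rfl⟩
  · intro x hx
    rcases he.mem_cases ⟨F, hF, hx⟩ with ⟨y, hy, rfl⟩ | ⟨h1, -⟩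
    · exact hK y hy
    · exact hS.fresh_mem h1

/-- Bags of existing nodes grow by facts over the same constants. -/
theorem Reach.growth (hSig : ∀ τ ∈ Sig, τ.IsGuarded) {p q : Position ar C} (h : Reach Sig K p q)
    (hp : Sound K p.1 p.2) : p.1.facts ⊆ q.1.facts ∧ p.1.nodes ⊆ q.1.nodes ∧
      ∀ n ∈ p.1.nodes, p.1.bag n ⊆ q.1.bag n ∧
        termsOf (q.1.bag n) = termsOf (p.1.bag n) ∧
        q.1.bag n ⊆ p.1.bag n ∪ newFacts Sig K := by
  induction h with
  | refl => exact ⟨subset_rfl, subset_rfl, fun n hn => ⟨subset_rfl, rfl, Set.subset_union_left⟩⟩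
  | tail hr hm ih =>
    have hs := Reach.sound hSig hr hp
    cases hm with
    | pop huv => exact ih
    | @step S v k τ η h e hk hτ hb hK hη he =>
      refine ⟨ih.1.trans ?_, ih.2.1.trans (nodes_subset_advance hs.mem), ?_⟩
      · rw [facts_advance hs.mem hk]
        exact Set.subset_union_left
      · intro n hn
        obtain ⟨h1, h2, h3⟩ := ih.2.2 n hn
        have hn' := ih.2.1 hn
        have hsub : S.bag n ⊆ (S.advance v k τ η e).bag n := bag_subset_advance hs.mem hk hn'
        have hterms : termsOf ((S.advance v k τ η e).bag n) = termsOf (S.bag n) :=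
          termsOf_advance hs.mem hk (hSig τ hτ) hb he hn'
        refine ⟨h1.trans hsub, hterms.trans h2, ?_⟩
        have hnew : (S.advance v k τ η e).bag n ⊆ S.bag n ∪ newFacts Sig K := by
          -- Ancestors of `v` were closed before the step, so they can only receive facts created by
          -- it; other bags do not change.
          by_cases hnv : n <:+ v
          · intro F hF
            have hF' : F ∈ (S.advance v k τ η e).facts :=
              ⟨n, nodes_subset_advance hs.mem hn', hF⟩
            rw [facts_advance hs.mem hk] at hF'
            rcases hF' with hF' | hF'
            · obtain ⟨G, hG, hFG⟩ :=
                exists_guard_of_advance hs.mem hk (hSig τ hτ) hb he hn' hF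
              exact Or.inl (hs.closed n hnv F hF' G hG hFG)
            · exact Or.inr (ground_subset_newFacts hs hτ hK hη he hF')
          · have := (sameSubtree_advance (τ := τ) (η := η) (e := e) hs.mem hn' hk hnv n
              List.suffix_rfl).2
            rw [← this]
            exact Set.subset_union_left
        intro F hF
        rcases hnew hF with hF | hF
        · exact h3 hF
        · exact Or.inr hF

end Game

/-! ### Saturation of losing positions -/

section Saturation

variable {R : Type u} {ar : R → ℕ} {C : Type v} {V : Type w}
  {Sig Sig₀ : Set (DisTGD ar V)} {K : Set C} {W : Set (Set (Fact ar C))}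

open BagTree

/-- If all branches of the step were winning, the step would be a winning strategy. A fresh child
name exists because the tree is finite. -/
theorem Sound.exists_losing_step {S : BagTree ar C} {v : List ℕ} (hS : Sound K S v)
    (hL : ¬ Winning Sig W S v) {τ : DisTGD ar V} {h : V → C} (hτ : τ ∈ Sig)
    (hb : ground h τ.body ⊆ S.bag v) :
    ∃ k η e, k :: v ∉ S.nodes ∧ η ∈ τ.head ∧ τ.IsFreshExtension η h e S.facts ∧
      ¬ Winning Sig W (S.advance v k τ η e) (focus τ η v k) := by
  obtain ⟨k, hk⟩ : ∃ k, k :: v ∉ S.nodes := by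
    by_contra! hall
    exact Set.infinite_of_injective_forall_mem (f := fun k : ℕ => k :: v)
      (fun a b hab => (List.cons.inj hab).1) hall hS.finite_nodes
  choose e he using fun η : {η // η ∈ τ.head} =>
    τ.exists_freshExtension η.1 h hS.infinite_fresh
  by_contra! hall
  exact hL (.step e List.suffix_rfl hS.mem hk hτ hb he
    fun η => hall k η.1 (e η) hk η.2 (he η))

/-- The bag of `v` does not change in losing positions reached from `(S, v)` while `v` is
active. -/
def Stable (Sig : Set (DisTGD ar V)) (W : Set (Set (Fact ar C))) (Sig₀ : Set (DisTGD ar V))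
    (K : Set C) (S : BagTree ar C) (v : List ℕ) : Prop :=
  ∀ q : Position ar C, Reach Sig₀ K (S, v) q → v <:+ q.2 → ¬ Winning Sig W q.1 q.2 →
    q.1.bag v = S.bag v

/-- Among the reachable losing positions at or below `v`, take one where the bag of `v` contains the
most facts of a finite set `X` that includes everything it can gain; then return to `v`. -/
theorem Sound.exists_stable (hg : ∀ τ ∈ Sig₀, τ.IsGuarded) (hfin : Sig₀.Finite)
    {S : BagTree ar C} {v : List ℕ} (hS : Sound K S v) (hL : ¬ Winning Sig W S v) :
    ∃ S', Reach Sig₀ K (S, v) (S', v) ∧ ¬ Winning Sig W S' v ∧ Stable Sig W Sig₀ K S' v := by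
  classical
  set X : Set (Fact ar C) :=
    {F | F.rel ∈ headRels Sig₀ ∧ F.terms ⊆ termsOf (S.bag v) ∩ K} with hX
  have hXfin : X.Finite := finite_facts_over (finite_headRels hfin) (hS.finite_terms v hS.mem)
  have hgrow : ∀ q : Position ar C, Reach Sig₀ K (S, v) q →
      q.1.bag v ⊆ S.bag v ∪ (q.1.bag v ∩ X) := by
    intro q hq F hF
    obtain ⟨-, h2, h3⟩ := (hq.growth hg hS).2.2 v hS.mem
    rcases h3 hF with h | h
    · exact Or.inl h
    · refine Or.inr ⟨hF, h.1, fun x hx => ⟨?_, h.2 hx⟩⟩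
      change x ∈ termsOf ((S, v).1.bag v)
      rw [← h2]
      exact ⟨F, hF, hx⟩
  let P : ℕ → Prop := fun n => ∃ q : Position ar C, Reach Sig₀ K (S, v) q ∧ v <:+ q.2 ∧
    ¬ Winning Sig W q.1 q.2 ∧ (q.1.bag v ∩ X).ncard = n
  have hbound : ∀ q : Position ar C, (q.1.bag v ∩ X).ncard ≤ X.ncard := fun q =>
    Set.ncard_le_ncard Set.inter_subset_right hXfin
  have hP : P (Nat.findGreatest P X.ncard) :=
    Nat.findGreatest_spec (hbound (S, v)) ⟨(S, v), .refl, List.suffix_rfl, hL, rfl⟩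
  obtain ⟨⟨S', v'⟩, hq, hv', hL', hcard⟩ := hP
  have hpop : Reach Sig₀ K (S, v) (S', v) := hq.tail (.pop hv')
  refine ⟨S', hpop, fun h => hL' (h.of_suffix hv'), ?_⟩
  intro q hq' hvq hLq
  have hS' := hpop.sound hg hS
  have hsub : S'.bag v ⊆ q.1.bag v := ((hq'.growth hg hS').2.2 v hS'.mem).1
  have hle : (q.1.bag v ∩ X).ncard ≤ Nat.findGreatest P X.ncard :=
    Nat.le_findGreatest (hbound q) ⟨q, hpop.trans hq', hvq, hLq, rfl⟩
  -- The bag only grows and its count in `X` is already maximal.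
  have heq : S'.bag v ∩ X = q.1.bag v ∩ X :=
    Set.eq_of_subset_of_ncard_le (Set.inter_subset_inter_left _ hsub) (hle.trans hcard.ge)
      (hXfin.subset Set.inter_subset_right)
  refine Set.Subset.antisymm (fun F hF => ?_) hsub
  rcases hgrow q (hpop.trans hq') hF with h | h
  · exact ((hpop.growth hg hS).2.2 v hS.mem).1 h
  · rw [← heq] at h
    exact h.1

/-- Up to depth `d` below `n`, all triggers are satisfied by a bag or one of its children, and all
bags contain the facts that they guard. -/
def Complete (Sig : Set (DisTGD ar V)) (K : Set C) (S : BagTree ar C) : ℕ → List ℕ → Prop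
  | 0, n => n ∈ S.nodes ∧ S.Closed n
  | d + 1, n => n ∈ S.nodes ∧ S.Closed n ∧ ∀ τ ∈ Sig, ∀ h : V → C,
      ground h τ.body ⊆ S.bag n → (∀ y ∈ τ.bodyVars, h y ∈ K) →
      ∃ η ∈ τ.head, ∃ e, Set.EqOn e h τ.bodyVars ∧ (∀ y ∈ τ.exVars η, e y ∈ K) ∧
        (ground e η ⊆ S.bag n ∨
          ∃ k, ground e η ⊆ S.bag (k :: n) ∧ Complete Sig K S d (k :: n))

/-- The satisfaction of a trigger in the definition of `Complete`. -/
def Satisfied (Sig : Set (DisTGD ar V)) (K : Set C) (S : BagTree ar C) (d : ℕ) (n : List ℕ)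
    (τ : DisTGD ar V) (h : V → C) : Prop :=
  ∃ η ∈ τ.head, ∃ e, Set.EqOn e h τ.bodyVars ∧ (∀ y ∈ τ.exVars η, e y ∈ K) ∧
    (ground e η ⊆ S.bag n ∨ ∃ k, ground e η ⊆ S.bag (k :: n) ∧ Complete Sig K S d (k :: n))

theorem complete_succ {S : BagTree ar C} {d : ℕ} {n : List ℕ} :
    Complete Sig K S (d + 1) n ↔ n ∈ S.nodes ∧ S.Closed n ∧ ∀ τ ∈ Sig, ∀ h : V → C,
      ground h τ.body ⊆ S.bag n → (∀ y ∈ τ.bodyVars, h y ∈ K) → Satisfied Sig K S d n τ h :=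
  Iff.rfl

theorem Complete.mem {S : BagTree ar C} {d : ℕ} {n : List ℕ} (h : Complete Sig K S d n) :
    n ∈ S.nodes := by
  cases d with
  | zero => exact h.1
  | succ d => exact h.1

theorem Complete.closed {S : BagTree ar C} {d : ℕ} {n : List ℕ} (h : Complete Sig K S d n) :
    S.Closed n := by
  cases d with
  | zero => exact h.2
  | succ d => exact h.2.1

theorem Satisfied.imp {S S' : BagTree ar C} {d d' : ℕ} {n : List ℕ} {τ : DisTGD ar V} {h : V → C}
    (hs : Satisfied Sig K S d n τ h) (hn : S.bag n ⊆ S'.bag n)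
    (hc : ∀ k, Complete Sig K S d (k :: n) →
      S.bag (k :: n) ⊆ S'.bag (k :: n) ∧ Complete Sig K S' d' (k :: n)) :
    Satisfied Sig K S' d' n τ h := by
  obtain ⟨η, hη, e, h1, h2, h3 | ⟨k, h3, h4⟩⟩ := hs
  · exact ⟨η, hη, e, h1, h2, Or.inl (h3.trans hn)⟩
  · exact ⟨η, hη, e, h1, h2, Or.inr ⟨k, h3.trans (hc k h4).1, (hc k h4).2⟩⟩

theorem Complete.of_succ {S : BagTree ar C} {d : ℕ} {n : List ℕ}
    (h : Complete Sig K S (d + 1) n) : Complete Sig K S d n := by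
  induction d generalizing n with
  | zero => exact ⟨h.1, h.2.1⟩
  | succ d ih =>
    exact ⟨h.1, h.2.1, fun τ hτ g hb hK =>
      Satisfied.imp (h.2.2 τ hτ g hb hK) subset_rfl fun k hk => ⟨subset_rfl, ih hk⟩⟩

/-- A closed bag stays closed if facts are added elsewhere and the bag of its parent is
unaffected. -/
theorem BagTree.Closed.transfer {S S' : BagTree ar C} {k : ℕ} {n v : List ℕ} (hS' : Sound K S' v)
    (hsame : SameSubtree (k :: n) S S') (hkn : k :: n ∈ S.nodes) (hn : n ∈ S.nodes)
    (hbag : S'.bag n = S.bag n) (hcn : S'.Closed n) (hc : S.Closed (k :: n)) :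
    S'.Closed (k :: n) := by
  have hself := hsame (k :: n) List.suffix_rfl
  intro F hF G hG hFG
  rw [← hself.2] at hG ⊢
  refine hc F ?_ G hG hFG
  obtain ⟨m, hm, hFm⟩ := hF
  by_cases hkm : k :: n <:+ m
  · exact ⟨m, (hsame m hkm).1.2 hm, by rw [(hsame m hkm).2]; exact hFm⟩
  · obtain ⟨G', hG', hx⟩ := hS'.guard k n (hself.1.1 hkn)
    have : F ∈ S'.bag n := by
      refine hcn F ⟨m, hm, hFm⟩ G' hG' fun x hxF => hx x ?_ m hm hkm ⟨F, hFm, hxF⟩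
      rw [← hself.2]
      exact ⟨G, hG, hFG hxF⟩
    rw [hbag] at this
    exact ⟨n, hn, this⟩

/-- Closedness is handed down from parent to child. Only the topmost parent lies outside the
unchanged subtree, which is why its bag and closedness are separate hypotheses. -/
theorem Complete.transfer {S S' : BagTree ar C} {v : List ℕ} (hS' : Sound K S' v)
    {d k : ℕ} {n : List ℕ} (hsame : SameSubtree (k :: n) S S') (hn : n ∈ S.nodes)
    (hbag : S'.bag n = S.bag n) (hcn : S'.Closed n) (hc : Complete Sig K S d (k :: n)) :
    Complete Sig K S' d (k :: n) := by
  induction d generalizing k n with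
  | zero =>
    exact ⟨(hsame _ List.suffix_rfl).1.1 hc.mem,
      BagTree.Closed.transfer hS' hsame hc.mem hn hbag hcn hc.closed⟩
  | succ d ih =>
    have hself := hsame (k :: n) List.suffix_rfl
    have hclosed := BagTree.Closed.transfer hS' hsame hc.mem hn hbag hcn hc.closed
    refine ⟨hself.1.1 hc.mem, hclosed, fun τ hτ h hb hK => ?_⟩
    rw [← hself.2] at hb
    refine Satisfied.imp (hc.2.2 τ hτ h hb hK) hself.2.subset fun k' hk' => ?_
    have hsame' : SameSubtree (k' :: k :: n) S S' := fun m hm =>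
      hsame m ((List.suffix_cons k' (k :: n)).trans hm)
    exact ⟨(hsame' _ List.suffix_rfl).2.subset, ih hsame' hc.mem hself.2.symm hclosed hk'⟩

/-- Finitely many triggers represent all of them. -/
theorem Sound.exists_finite_triggers (hfin : Sig.Finite) {S : BagTree ar C} {v : List ℕ}
    (hS : Sound K S v) : ∃ P : Set (DisTGD ar V × (V → C)), P.Finite ∧
      (∀ p ∈ P, p.1 ∈ Sig ∧ ground p.2 p.1.body ⊆ S.bag v ∧ ∀ y ∈ p.1.bodyVars, p.2 y ∈ K) ∧
      ∀ τ ∈ Sig, ∀ h : V → C, ground h τ.body ⊆ S.bag v → (∀ y ∈ τ.bodyVars, h y ∈ K) →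
        ∃ h', (τ, h') ∈ P ∧ Set.EqOn h h' τ.bodyVars := by
  let A : Set (DisTGD ar V × (V → C)) := {p | p.1 ∈ Sig ∧ ground p.2 p.1.body ⊆ S.bag v ∧
    ∀ y ∈ p.1.bodyVars, p.2 y ∈ K}
  -- A trigger matters only through its graph on the finitely many body variables; `P` picks one
  -- trigger per graph.
  let f : DisTGD ar V × (V → C) → DisTGD ar V × Set (V × C) := fun p =>
    (p.1, {z | z.1 ∈ p.1.bodyVars ∧ p.2 z.1 = z.2})
  have hA : (f '' A).Finite := by
    have hX := hS.finite_terms v hS.mem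
    have : f '' A ⊆ ⋃ τ ∈ Sig, {τ} ×ˢ 𝒫 (τ.bodyVars ×ˢ (termsOf (S.bag v) ∩ K)) := by
      rintro _ ⟨⟨τ, h⟩, ⟨hτ, hb, hK⟩, rfl⟩
      refine Set.mem_biUnion hτ ⟨rfl, ?_⟩
      rintro ⟨y, c⟩ ⟨hy, hyc⟩
      change h y = c at hyc
      subst hyc
      refine ⟨hy, termsOf_mono hb ?_, hK y hy⟩
      rw [termsOf_ground]
      exact ⟨y, hy, rfl⟩
    exact (hfin.biUnion fun τ _ =>
      (Set.finite_singleton τ).prod ((finite_termsOf τ.body).prod hX).powerset).subset this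
  obtain ⟨P, hPA, hP⟩ := Set.exists_subset_bijOn A f
  refine ⟨P, hP.finite_iff_finite.2 hA, fun p hp => hPA hp, fun τ hτ h hb hK => ?_⟩
  obtain ⟨⟨τ', h'⟩, hp, heq⟩ := hP.surjOn ⟨(τ, h), ⟨hτ, hb, hK⟩, rfl⟩
  obtain ⟨h1, h2⟩ := Prod.mk.inj heq
  change τ' = τ at h1
  subst h1
  refine ⟨h', hp, fun y hy => ?_⟩
  have : (y, h y) ∈ {z : V × C | z.1 ∈ τ'.bodyVars ∧ h' z.1 = z.2} := by
    change {z : V × C | z.1 ∈ τ'.bodyVars ∧ h' z.1 = z.2} = _ at h2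
    rw [h2]
    exact ⟨hy, rfl⟩
  exact this.2.symm

/-- From a losing position one can reach a losing one in which the current node is complete up to
a given depth. -/
theorem Sound.exists_complete (hg : ∀ τ ∈ Sig₀, τ.IsGuarded) (hfin : Sig₀.Finite)
    (hsub : Sig₀ ⊆ Sig) (d : ℕ) {S : BagTree ar C} {v : List ℕ} (hS : Sound K S v)
    (hL : ¬ Winning Sig W S v) :
    ∃ S', Reach Sig₀ K (S, v) (S', v) ∧ ¬ Winning Sig W S' v ∧ Complete Sig₀ K S' d v := by
  induction d generalizing S v with
  | zero => exact ⟨S, .refl, hL, hS.mem, hS.closed v List.suffix_rfl⟩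
  | succ d ih =>
    obtain ⟨S₁, hr₁, hL₁, hst⟩ := hS.exists_stable hg hfin hL
    have hS₁ : Sound K S₁ v := hr₁.sound hg hS
    obtain ⟨P, hPfin, hP, hrep⟩ := hS₁.exists_finite_triggers hfin
    obtain ⟨S₂, hr₂, hL₂, hsat⟩ : ∃ S₂, Reach Sig₀ K (S₁, v) (S₂, v) ∧
        ¬ Winning Sig W S₂ v ∧ ∀ p ∈ P, Satisfied Sig₀ K S₂ d v p.1 p.2 := by
      -- Triggers are treated one at a time. Stability keeps the bag of `v` equal to that of `S₁`,
      -- so no trigger disappears and no new one arises.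
      refine hPfin.induction_on_subset
        (motive := fun Q _ => ∃ S₂, Reach Sig₀ K (S₁, v) (S₂, v) ∧
          ¬ Winning Sig W S₂ v ∧ ∀ p ∈ Q, Satisfied Sig₀ K S₂ d v p.1 p.2)
        P ⟨S₁, .refl, hL₁, fun p hp => absurd hp (Set.notMem_empty p)⟩ ?_
      rintro ⟨τ, h⟩ Q hpP hQP hpQ ⟨S₂, hr₂, hL₂, hsat⟩
      obtain ⟨hτ, hb, hK⟩ := hP _ hpP
      have hS₂ : Sound K S₂ v := hr₂.sound hg hS₁
      have hbag₂ : S₂.bag v = S₁.bag v := hst _ hr₂ List.suffix_rfl hL₂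
      rw [← hbag₂] at hb
      obtain ⟨k, η, e, hk, hη, he, hLn⟩ := hS₂.exists_losing_step hL₂ (hsub hτ) hb
      have hmove : Reach Sig₀ K (S₂, v) (S₂.advance v k τ η e, focus τ η v k) :=
        Relation.ReflTransGen.single (.step hk hτ hb hK hη he)
      have hSn := hmove.sound hg hS₂
      have hexK : ∀ y ∈ τ.exVars η, e y ∈ K := fun y hy => hS₂.fresh_mem (he.2.2 y hy)
      obtain ⟨S₃, hr₃, hL₃, hnew⟩ : ∃ S₃, Reach Sig₀ K (S₂, v) (S₃, v) ∧
          ¬ Winning Sig W S₃ v ∧ Satisfied Sig₀ K S₃ d v τ h := by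
        have hground : ground e η ⊆ (S₂.advance v k τ η e).bag (focus τ η v k) :=
          ground_subset_advance hS₂.mem
        rcases focus_cases τ η v k with ⟨h1, h2⟩ | ⟨h1, h2⟩
        · rw [h2] at hmove hLn hground
          exact ⟨_, hmove, hLn, η, hη, e, he.1, hexK, Or.inl hground⟩
        · rw [h2] at hmove hLn hground hSn
          -- The new child is completed to depth `d` before it is left for good.
          obtain ⟨S₃, hr₃, hL₃, hcomp⟩ := ih hSn hLn
          refine ⟨S₃, (hmove.trans hr₃).tail (.pop (List.suffix_cons k v)),
            fun hw => hL₃ (hw.of_suffix (List.suffix_cons k v)), η, hη, e, he.1, hexK,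
            Or.inr ⟨k, hground.trans ?_, hcomp⟩⟩
          exact ((hr₃.growth hg hSn).2.2 _ hSn.mem).1
      have hS₃ : Sound K S₃ v := hr₃.sound hg hS₂
      have hbag₃ : S₃.bag v = S₂.bag v :=
        (hst _ (hr₂.trans hr₃) List.suffix_rfl hL₃).trans hbag₂.symm
      refine ⟨S₃, hr₂.trans hr₃, hL₃, ?_⟩
      rintro p (rfl | hp)
      · exact hnew
      · refine (hsat p hp).imp hbag₃.symm.subset fun k' hk' => ?_
        have hnot : ¬ k' :: v <:+ v := fun hs => by
          have := hs.length_le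
          simp at this
        -- Children that satisfied earlier triggers have been left, so their subtrees are unchanged.
        have hsame := (hr₃.frozen hg hS₂ hk'.mem hnot).1
        exact ⟨(hsame _ List.suffix_rfl).2.subset,
          hk'.transfer hS₃ hsame hS₂.mem hbag₃ (hS₃.closed v List.suffix_rfl)⟩
    have hS₂ : Sound K S₂ v := hr₂.sound hg hS₁
    refine ⟨S₂, hr₁.trans hr₂, hL₂, complete_succ.2
      ⟨hS₂.mem, hS₂.closed v List.suffix_rfl, fun τ hτ h hb hK => ?_⟩⟩
    rw [show S₂.bag v = S₁.bag v from hst _ hr₂ List.suffix_rfl hL₂] at hb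
    obtain ⟨h', hp, heq⟩ := hrep τ hτ h hb hK
    obtain ⟨η, hη, e, h1, h2⟩ := hsat _ hp
    exact ⟨η, hη, e, h1.trans heq.symm, h2⟩

end Saturation

/-! ### Chase trees and complete trees of bags -/

namespace ChaseTree

variable {R : Type u} {ar : R → ℕ} {C : Type v} {V : Type w} {δ : Type x}

/-- The dependencies used in a chase tree. -/
def rules : ChaseTree ar C V δ → Set (DisTGD ar V)
  | leaf => ∅
  | step _ τ _ _ children => {τ} ∪ ⋃ η, rules (children η)

/-- The constants to which triggers of a chase tree map body variables. -/
def triggerConsts : ChaseTree ar C V δ → Set C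
  | leaf => ∅
  | step _ τ h _ children => h '' τ.bodyVars ∪ ⋃ η, triggerConsts (children η)

theorem finite_rules (T : ChaseTree ar C V δ) : T.rules.Finite := by
  induction T with
  | leaf => exact Set.finite_empty
  | step d τ h e children ih => exact (Set.finite_singleton τ).union (Set.finite_iUnion ih)

theorem finite_triggerConsts (T : ChaseTree ar C V δ) : T.triggerConsts.Finite := by
  induction T with
  | leaf => exact Set.finite_empty
  | step d τ h e children ih =>
    exact ((finite_termsOf τ.body).image h).union (Set.finite_iUnion ih)

theorem IsChaseTree.rules_subset {Sig : Set (DisTGD ar V)} {T : ChaseTree ar C V δ}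
    {I : Set (Fact ar C)} (h : T.IsChaseTree Sig I) : T.rules ⊆ Sig := by
  induction T generalizing I with
  | leaf => exact Set.empty_subset _
  | step d τ g e children ih =>
    exact Set.union_subset (Set.singleton_subset_iff.2 h.1)
      (Set.iUnion_subset fun η => ih η (h.2.2 η).2)

/-- A chase tree has a leaf that maps into a sufficiently complete tree of bags. -/
theorem exists_hom (Sig Sig₀ : Set (DisTGD ar V)) (K : Set C) (D : Set (Fact ar C))
    (hg : ∀ τ ∈ Sig₀, τ.IsGuarded) (T : ChaseTree ar C V δ) :
    ∃ d₀, ∀ d ≥ d₀, ∀ (S : BagTree ar C) (I : Set (Fact ar C)) (g : C → C),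
      T.IsChaseTree Sig I → T.rules ⊆ Sig₀ →
      T.triggerConsts ⊆ K ∪ (termsOf D)ᶜ → D ⊆ I →
      (∀ c ∈ termsOf D, g c = c) → (∀ c ∉ termsOf D, g c ∈ K) →
      (∀ F ∈ I, ∃ n, Complete Sig₀ K S d n ∧ F.map g ∈ S.bag n) →
      ∃ L ∈ T.leaves I, ∃ g' : C → C, IsHom g' L S.facts ∧ ∀ c ∈ termsOf D, g' c = c := by
  induction T with
  | leaf =>
    refine ⟨0, fun d _ S I g _ _ _ _ hgD _ hI => ⟨I, rfl, g, fun F hF => ?_, hgD⟩⟩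
    obtain ⟨n, hn, hFn⟩ := hI F hF
    exact ⟨n, hn.mem, hFn⟩
  | step δ' τ h e children ih =>
    classical
    choose d₀ hd using ih
    -- One level pays for this step, since a new child is complete only to one level less; the
    -- supremum serves whichever disjunct is realised.
    refine ⟨Finset.univ.sup d₀ + 1, ?_⟩
    intro d' hd' S I g hT hrules hconsts hDI hgD hgK hI
    obtain ⟨d, rfl⟩ : ∃ d, d' = d + 1 := ⟨d' - 1, by omega⟩
    obtain ⟨-, htrig, hch⟩ := hT
    have hτ : τ ∈ Sig₀ := hrules (Or.inl rfl)
    obtain ⟨G, hG, hGτ⟩ := hg τ hτ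
    obtain ⟨n, hn, hGn⟩ := hI (G.map h) (htrig ⟨G, hG, rfl⟩)
    have hb : ground (g ∘ h) τ.body ⊆ S.bag n := by
      rintro _ ⟨A, hA, rfl⟩
      -- The body atoms may be mapped into different bags, but the closed bag `n` holding the image
      -- of the guard contains them all.
      obtain ⟨m, hm, hAm⟩ := hI (A.map h) (htrig ⟨A, hA, rfl⟩)
      refine hn.closed _ ⟨m, hm.mem, hAm⟩ _ hGn ?_
      rw [Atom.map_map, Atom.terms_map, Atom.terms_map]
      exact Set.image_mono (hGτ A hA)
    have hK : ∀ y ∈ τ.bodyVars, (g ∘ h) y ∈ K := by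
      intro y hy
      by_cases hyD : h y ∈ termsOf D
      · have := (hconsts (Or.inl ⟨y, hy, rfl⟩)).resolve_right (fun h' => h' hyD)
        rw [Function.comp_apply, hgD _ hyD]
        exact this
      · exact hgK _ hyD
    obtain ⟨η, hη, e', he', hexK, hsat⟩ := hn.2.2 τ hτ (g ∘ h) hb hK
    obtain ⟨hfresh, hchild⟩ := hch ⟨η, hη⟩
    set e₁ := e ⟨η, hη⟩ with he₁
    -- The fresh constants of `T` are redirected to the values realised in `S`; injectivity of `e₁`
    -- on the existential variables makes this well defined.
    let g' : C → C := fun c => if hc : ∃ y ∈ τ.exVars η, e₁ y = c then e' hc.choose else g c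
    have hg'old : ∀ c ∈ termsOf I, g' c = g c := by
      intro c hc
      refine dif_neg ?_
      rintro ⟨y, hy, rfl⟩
      exact hfresh.2.2 y hy hc
    have hg'new : ∀ y ∈ τ.exVars η, g' (e₁ y) = e' y := by
      intro y hy
      have hc : ∃ z ∈ τ.exVars η, e₁ z = e₁ y := ⟨y, hy, rfl⟩
      have : hc.choose = y := hfresh.2.1 hc.choose_spec.1 hy hc.choose_spec.2
      change (if hc : ∃ z ∈ τ.exVars η, e₁ z = e₁ y then e' hc.choose else g (e₁ y)) = _
      rw [dif_pos hc, this]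
    have hcomp : Set.EqOn (g' ∘ e₁) e' (termsOf (η : Set (Atom ar V))) := by
      intro y hy
      rcases τ.terms_subset η hy with hy | hy
      · rw [Function.comp_apply, hfresh.1 hy, he' hy]
        refine hg'old _ (termsOf_mono htrig ?_)
        rw [termsOf_ground]
        exact ⟨y, hy, rfl⟩
      · exact hg'new y hy
    obtain ⟨L, hL, g'', hg''⟩ := hd ⟨η, hη⟩ d
      ((Finset.le_sup (f := d₀) (Finset.mem_univ _)).trans (by omega))
      S (I ∪ ground e₁ η) g' hchild
      (fun ρ hρ => hrules (Or.inr (Set.mem_iUnion.2 ⟨⟨η, hη⟩, hρ⟩)))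
      (fun c hc => hconsts (Or.inr (Set.mem_iUnion.2 ⟨⟨η, hη⟩, hc⟩)))
      (hDI.trans Set.subset_union_left)
      (fun c hc => (hg'old c (termsOf_mono hDI hc)).trans (hgD c hc))
      (fun c hc => by
        by_cases h' : ∃ y ∈ τ.exVars η, e₁ y = c
        · obtain ⟨y, hy, rfl⟩ := h'
          rw [hg'new y hy]
          exact hexK y hy
        · change (if hc : ∃ y ∈ τ.exVars η, e₁ y = c then e' hc.choose else g c) ∈ K
          rw [dif_neg h']
          exact hgK c hc)
      (by
        rintro F (hF | hF)
        · obtain ⟨m, hm, hFm⟩ := hI F hF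
          refine ⟨m, hm.of_succ, ?_⟩
          rwa [Atom.map_congr fun c hc => hg'old c ⟨F, hF, hc⟩]
        · have hF' : F.map g' ∈ ground e' η := by
            obtain ⟨A, hA, rfl⟩ := hF
            exact ⟨A, hA, Atom.map_congr fun y hy => hcomp ⟨A, hA, hy⟩⟩
          rcases hsat with hsat | ⟨k, hsat, hk⟩
          · exact ⟨n, hn.of_succ, hsat hF'⟩
          · exact ⟨k :: n, hk, hsat hF'⟩)
    exact ⟨L, Set.mem_iUnion.2 ⟨⟨η, hη⟩, hL⟩, g'', hg''⟩

/-- The root position is winning by determinacy: a sufficiently complete losing position would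
already contain the image of a leaf of `T`. -/
theorem exists_onePass {Sig : Set (DisTGD ar V)} (hSig : ∀ τ ∈ Sig, τ.IsGuarded)
    {D : Set (Fact ar C)} (hD : (termsOf D)ᶜ.Infinite) {T : ChaseTree ar C V δ}
    (hT : T.IsChaseTree Sig D) :
    ∃ T' : ChaseTree ar C V Placement, T'.IsOnePass Sig D ∧
      ∀ L' ∈ T'.leaves D, ∃ L ∈ T.leaves D, ∃ g : C → C,
        IsHom g L L' ∧ ∀ c ∈ termsOf D, g c = c := by
  let W : Set (Set (Fact ar C)) := {L' | ∃ L ∈ T.leaves D, ∃ g : C → C,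
    IsHom g L L' ∧ ∀ c ∈ termsOf D, g c = c}
  have hfacts : (BagTree.single D).facts = D := BagTree.facts_single D
  suffices hw : Winning Sig W (BagTree.single D) [] by
    obtain ⟨T', h1, h2, h3, h4⟩ := hw.exists_chaseTree
    rw [hfacts] at h1 h3
    exact ⟨T', ⟨⟨h1, h2⟩, fun t ht => (h4 t ht).1⟩, h3⟩
  by_contra hL
  -- Only finitely many constants of `D` belong to `K`, so the root bag satisfies `finite_terms`
  -- even for infinite `D`.
  let K : Set C := T.triggerConsts ∪ (termsOf D)ᶜ
  have hsub : T.rules ⊆ Sig := hT.rules_subset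
  have hg : ∀ τ ∈ T.rules, τ.IsGuarded := fun τ hτ => hSig τ (hsub hτ)
  have hroot : ∀ n ∈ (BagTree.single D).nodes, n = [] := fun n hn => hn
  have hbag : (BagTree.single D).bag [] = D := by
    ext F
    simp [BagTree.single]
  have hS : Sound K (BagTree.single D) [] := by
    refine ⟨rfl, fun k n hn => absurd (hroot _ hn) (List.cons_ne_nil k n),
      Set.finite_singleton _, by rwa [hfacts], ?_, ?_, ?_,
      fun k n hn => absurd (hroot _ hn) (List.cons_ne_nil k n)⟩
    · rw [hfacts]
      exact Set.subset_union_right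
    · intro n hn
      rw [hroot n hn, hbag]
      refine T.finite_triggerConsts.subset ?_
      rintro c ⟨hc, hc' | hc'⟩
      · exact hc'
      · exact absurd hc hc'
    · intro n hn F hF G _ _
      rw [List.suffix_nil.1 hn, hbag]
      rwa [hfacts] at hF
  obtain ⟨d, hd⟩ := T.exists_hom Sig T.rules K D hg
  obtain ⟨S, hr, hLS, hc⟩ := hS.exists_complete hg T.finite_rules hsub d hL
  -- With `g = id`, all facts of `D` lie in the complete root bag, so `T` is followed from there.
  refine hLS (.leaf (hd d le_rfl S D id hT subset_rfl ?_ subset_rfl (fun c _ => rfl)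
    (fun c hc => Or.inr hc) fun F hF => ⟨[], hc, ?_⟩))
  · exact fun c hc => Or.inl (Or.inl hc)
  · refine ((hr.growth hg hS).2.2 [] rfl).1 ?_
    rw [hbag]
    exact hF

/-- Forget the data of the steps. -/
def forget : ChaseTree ar C V δ → ChaseTree ar C V Unit
  | leaf => leaf
  | step _ τ h e children => step () τ h e fun η => forget (children η)

theorem leaves_forget (T : ChaseTree ar C V δ) (I : Set (Fact ar C)) :
    T.forget.leaves I = T.leaves I := by
  induction T generalizing I with
  | leaf => rfl
  | step d τ h e children ih => exact Set.iUnion_congr fun η => ih η _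

theorem IsChaseTree.forget {Sig : Set (DisTGD ar V)} {T : ChaseTree ar C V δ}
    {I : Set (Fact ar C)} (hT : T.IsChaseTree Sig I) : T.forget.IsChaseTree Sig I := by
  induction T generalizing I with
  | leaf => trivial
  | step d τ h e children ih =>
    exact ⟨hT.1, hT.2.1, fun η => ⟨(hT.2.2 η).1, ih η (hT.2.2 η).2⟩⟩

end ChaseTree

/-- Queries over `D` are preserved by homomorphisms that fix the constants of `D`. -/
theorem UBCQ.Holds.of_isHom {R : Type u} {ar : R → ℕ} {C : Type v} {V : Type w}
    {Q : UBCQ ar C V} {D L L' : Set (Fact ar C)} (hQ : Q.Over D) (hL : Q.Holds L) {g : C → C}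
    (hg : IsHom g L L') (hgD : ∀ c ∈ termsOf D, g c = c) : Q.Holds L' := by
  obtain ⟨q, hq, s, hs⟩ := hL
  refine ⟨q, hq, g ∘ s, fun A hA => ?_⟩
  have := hg _ (hs A hA)
  rw [Atom.map_map] at this
  rwa [Atom.map_congr (g := g ∘ Sum.elim s id)]
  rintro (y | c) ht
  · rfl
  · exact (hgD c (hQ q hq A hA c ht)).symm

end DisChase

theorem mainTheorem6 {R : Type*} {C : Type*} {V : Type*} (ar : R → ℕ)
    (Sig : Set (DisChase.DisTGD ar V)) (hSig : ∀ τ ∈ Sig, τ.IsGuarded)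
    (D : Set (DisChase.Fact ar C)) (hD : (DisChase.termsOf D)ᶜ.Infinite) :
    (∀ Q : DisChase.UBCQ ar C V, DisChase.UBCQ.Over Q D →
      ((∃ T : DisChase.ChaseTree ar C V Unit, T.IsChaseProof Sig D Q) ↔
        ∃ T : DisChase.ChaseTree ar C V DisChase.Placement,
          T.IsOnePass Sig D ∧ T.IsChaseProof Sig D Q)) ∧
    (∀ T : DisChase.ChaseTree ar C V DisChase.Placement, T.IsTreeLike Sig D →
      ∃ T' : DisChase.ChaseTree ar C V DisChase.Placement, T'.IsOnePass Sig D ∧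
        ∀ L' ∈ T'.leaves D, ∃ L ∈ T.leaves D, ∃ g : C → C,
          DisChase.IsHom g L L' ∧ ∀ c ∈ DisChase.termsOf D, g c = c) := by
  refine ⟨fun Q hQ => ⟨?_, ?_⟩, fun T hT => DisChase.ChaseTree.exists_onePass hSig hD hT.1⟩
  · rintro ⟨T, hT, hTQ⟩
    obtain ⟨T', hT', hleaf⟩ := DisChase.ChaseTree.exists_onePass hSig hD hT
    refine ⟨T', hT', hT'.1.1, fun L' hL' => ?_⟩
    obtain ⟨L, hL, g, hg, hgD⟩ := hleaf L' hL'
    exact (hTQ L hL).of_isHom hQ hg hgD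
  · rintro ⟨T, -, hT, hTQ⟩
    refine ⟨T.forget, hT.forget, fun L hL => hTQ L ?_⟩
    rwa [DisChase.ChaseTree.leaves_forget] at hL
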